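/- For an integer $k\ge 0$ let $J_k$ and $I_k$ denote the Bessel function and the modified Bessel function of the first kind of order $k$. For $\kappa>0$ and $\alpha>0$ put $$F_k(\alpha)=\frac{\kappa}{\alpha}\,J_k(\alpha)\,I_k'\Bigl(\frac{\kappa}{\alpha}\Bigr)-\alpha\, I_k\Bigl(\frac{\kappa}{\alpha}\Bigr)J_k'(\alpha).$$ **Theorem 4.2.** Let $\kappa>0$ and let $k\ge 0$ be an integer. The function $F_k$ has a smallest positive root $\alpha_{k,1}$. Let $(c,d)\in\mathbb R^2\setminus\{(0,0)\}$ be any nontrivial solution of the system $$c\,J_k(\alpha_{k,1})+d\,I_k\Bigl(\frac{\kappa}{\alpha_{k,1}}\Bigr)=0,\qquad c\,\alpha_{k,1}J_k'(\alpha_{k,1})+d\,\frac{\kappa}{\alpha_{k,1}}\,I_k'\Bigl(\frac{\kappa}{\alpha_{k,1}}\Bigr)=0,$$ and let $$R_{k,1}(r)=c\,J_k(\alpha_{k,1}r)+d\,I_k\Bigl(\frac{\kappa}{\alpha_{k,1}}\,r\Bigr).$$ Then $|R_{k,1}(r)|>0$ for every $r\in(0,1)$. If $k=0$, then also $|R_{0,1}(0)|>0$,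 so that $|R_{0,1}|>0$ on $[0,1)$. -/

import Mathlib

noncomputable section

namespace BucklingDisk

/-- The Bessel function of the first kind `J_k` of integer order `k ≥ 0` on the real line, by its
power series `∑ (-1)^m / (m! (m+k)!) (x/2)^(2m+k)`. -/
def besselJ (k : ℕ) (x : ℝ) : ℝ :=
  ∑' m : ℕ, (-1 : ℝ) ^ m / ((m.factorial : ℝ) * ((m + k).factorial : ℝ)) * (x / 2) ^ (2 * m + k)

/-- The modified Bessel function of the first kind `I_k` of integer order `k ≥ 0` on the real line,
by its power series `∑ 1 / (m! (m+k)!) (x/2)^(2m+k)`. -/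
def besselI (k : ℕ) (x : ℝ) : ℝ :=
  ∑' m : ℕ, 1 / ((m.factorial : ℝ) * ((m + k).factorial : ℝ)) * (x / 2) ^ (2 * m + k)

/-- The series defining `I_k` converges (absolutely) everywhere. -/
theorem summable_besselI (k : ℕ) (x : ℝ) :
    Summable fun m : ℕ =>
      1 / ((m.factorial : ℝ) * ((m + k).factorial : ℝ)) * (x / 2) ^ (2 * m + k) := by
  have h := (Real.summable_pow_div_factorial ((x / 2) ^ 2)).mul_left (|x / 2| ^ k)
  refine Summable.of_norm_bounded h fun m => ?_
  have h1 : (1 : ℝ) ≤ ((m + k).factorial : ℝ) := by exact_mod_cast Nat.factorial_pos (m + k)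
  have h2 : (0 : ℝ) < (m.factorial : ℝ) := by exact_mod_cast Nat.factorial_pos m
  have e : ‖1 / ((m.factorial : ℝ) * ((m + k).factorial : ℝ)) * (x / 2) ^ (2 * m + k)‖
      = |x / 2| ^ k * (((x / 2) ^ 2) ^ m / ((m.factorial : ℝ) * ((m + k).factorial : ℝ))) := by
    rw [norm_mul, norm_div, norm_one, norm_mul, norm_pow, pow_add, pow_mul, Real.norm_eq_abs (x / 2),
      sq_abs, Real.norm_of_nonneg h2.le, Real.norm_of_nonneg (by linarith)]
    ring
  rw [e]
  gcongr
  nlinarith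

/-- The series defining `J_k` converges (absolutely) everywhere. -/
theorem summable_besselJ (k : ℕ) (x : ℝ) :
    Summable fun m : ℕ =>
      (-1 : ℝ) ^ m / ((m.factorial : ℝ) * ((m + k).factorial : ℝ)) * (x / 2) ^ (2 * m + k) := by
  refine Summable.of_norm ((summable_besselI k x).norm.congr fun m => ?_)
  simp [norm_mul, norm_div]

/-- `F_k(α) = (κ/α) J_k(α) I_k'(κ/α) - α I_k(κ/α) J_k'(α)`: the determinant of the clamped
boundary conditions. -/
def charF (κ : ℝ) (k : ℕ) (α : ℝ) : ℝ :=
  κ / α * besselJ k α * deriv (besselI k) (κ / α) - α * besselI k (κ / α) * deriv (besselJ k) α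

/-- The set of positive roots of `F_k`. -/
def posRoots (κ : ℝ) (k : ℕ) : Set ℝ := {α : ℝ | 0 < α ∧ charF κ k α = 0}

/-- `α_{k,1}`: the first positive root of `F_k`. -/
def alphaOne (κ : ℝ) (k : ℕ) : ℝ := sInf (posRoots κ k)

/-- The radial profile `R(r) = c J_k(α r) + d I_k(κ r / α)`. -/
def radial (κ : ℝ) (k : ℕ) (α c d r : ℝ) : ℝ :=
  c * besselJ k (α * r) + d * besselI k (κ / α * r)

/-- The linear system for `(c, d)` that expresses `R(1) = R'(1) = 0`. -/
def ClampedSystem (κ : ℝ) (k : ℕ) (α c d : ℝ) : Prop :=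
  c * besselJ k α + d * besselI k (κ / α) = 0 ∧
    c * α * deriv (besselJ k) α + d * (κ / α) * deriv (besselI k) (κ / α) = 0

end BucklingDisk

end

noncomputable section

namespace BucklingDisk

open Set Filter Topology

/-! Put `u(r) = J_k(αr)`, `v(r) = I_k(κr/α)` and `W = r (u v' - v u')`. The Bessel equations give
`W' = (α² + κ²/α²) r u v`, while `W(0) = 0` and `W(1) = F_k(α)`. Since `v > 0` on `(0, 1]`, the sign
of `W'` is that of `J_k` (`hasDerivAt_besselWronskian`).

At the first root, `J_k` changes sign exactly once on `(0, α)` (`exists_besselJ_sign_change`), so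
`W` rises from 0 and falls back to 0, and `W > 0` on `(0, 1)`. As `(u/v)' = -W/(r v²)`, the quotient
`u/v` is strictly decreasing. It equals `-d/c` at 1, hence nowhere else, and `R = c u + d v` has no
other zero.

The single sign change holds because `F_k > 0` and `J_k ≤ 0` force `J_k' < 0`: once nonpositive,
`J_k` stays negative as long as `F_k > 0`. Without any root this would keep `J_k` negative for ever,
which Sturm comparison excludes (`posRoots_nonempty`). -/

/-! ### The power series common to `J_k` and `I_k` -/

/-- The entire function `∑ t^m / (m! (m+k)!)` underlying both `J_k` and `I_k`. -/
def besselSeries (k : ℕ) (t : ℝ) : ℝ :=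
  ∑' m : ℕ, t ^ m / ((m.factorial : ℝ) * ((m + k).factorial : ℝ))

theorem norm_besselSeries_term_le (k m : ℕ) (t : ℝ) :
    ‖t ^ m / ((m.factorial : ℝ) * ((m + k).factorial : ℝ))‖ ≤ |t| ^ m / (m.factorial : ℝ) := by
  have h1 : (1 : ℝ) ≤ ((m + k).factorial : ℝ) := by exact_mod_cast Nat.factorial_pos (m + k)
  have h2 : (0 : ℝ) < (m.factorial : ℝ) := by exact_mod_cast Nat.factorial_pos m
  rw [norm_div, norm_pow, Real.norm_eq_abs, Real.norm_of_nonneg (by positivity)]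
  gcongr
  nlinarith

theorem summable_besselSeries (k : ℕ) (t : ℝ) :
    Summable fun m : ℕ => t ^ m / ((m.factorial : ℝ) * ((m + k).factorial : ℝ)) :=
  Summable.of_norm_bounded (Real.summable_pow_div_factorial |t|)
    fun m => norm_besselSeries_term_le k m t

theorem besselSeries_deriv_term (k m : ℕ) (t : ℝ) :
    ((m + 1 : ℕ) : ℝ) * t ^ m / (((m + 1).factorial : ℝ) * ((m + 1 + k).factorial : ℝ))
      = t ^ m / ((m.factorial : ℝ) * ((m + (k + 1)).factorial : ℝ)) := by
  have h2 : (m.factorial : ℝ) ≠ 0 := by exact_mod_cast Nat.factorial_ne_zero m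
  have h3 : ((m + (k + 1)).factorial : ℝ) ≠ 0 := by exact_mod_cast Nat.factorial_ne_zero _
  have h4 : ((m : ℝ) + 1) ≠ 0 := by positivity
  rw [show m + 1 + k = m + (k + 1) by ring, Nat.factorial_succ m]
  push_cast
  field_simp

theorem hasDerivAt_besselSeries (k : ℕ) (t : ℝ) :
    HasDerivAt (besselSeries k) (besselSeries (k + 1) t) t := by
  set f' : ℕ → ℝ → ℝ := fun m y =>
    (m : ℝ) * y ^ (m - 1) / ((m.factorial : ℝ) * ((m + k).factorial : ℝ)) with hf'
  have hshift : ∀ m y, f' (m + 1) y = y ^ m / ((m.factorial : ℝ) * ((m + (k + 1)).factorial : ℝ)) :=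
    fun m y => besselSeries_deriv_term k m y
  -- The truncated exponent `0 - 1` is harmless, its coefficient being 0.
  have hzero : ∀ y, f' 0 y = 0 := fun y => by simp [hf']
  have hR : |t| < |t| + 1 := by linarith
  set R := |t| + 1
  have hR0 : 0 < R := by positivity
  -- The differentiated series at `R` itself dominates the one at each point of the ball of radius
  -- `R`.
  have hu : Summable fun m : ℕ => f' m R := by
    rw [← summable_nat_add_iff 1]
    simpa only [hshift] using summable_besselSeries (k + 1) R
  have key := hasDerivAt_tsum_of_isPreconnected (t := Metric.ball (0 : ℝ) R) (y₀ := t) (y := t)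
    (g := fun (m : ℕ) y => y ^ m / ((m.factorial : ℝ) * ((m + k).factorial : ℝ))) (g' := f') hu
    Metric.isOpen_ball (convex_ball (0 : ℝ) R).isPreconnected
    (fun m y _ => (hasDerivAt_pow m y).div_const _) ?_ (by simpa using hR)
    (summable_besselSeries k t) (by simpa using hR)
  · have e : ∑' m, f' m t = besselSeries (k + 1) t := by
      have hs : Summable fun m : ℕ => f' m t := by
        rw [← summable_nat_add_iff 1]
        simpa only [hshift] using summable_besselSeries (k + 1) t
      rw [hs.tsum_eq_zero_add, hzero, zero_add]
      simp only [hshift]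
      rfl
    rw [e] at key
    exact key
  · intro m y hy
    have hy' : |y| ≤ R := by simpa using (mem_ball_zero_iff.1 hy).le
    simp only [hf']
    rw [norm_div, norm_mul, norm_pow, Real.norm_eq_abs y, Real.norm_of_nonneg (by positivity),
      Real.norm_of_nonneg (by positivity)]
    gcongr

theorem continuous_besselSeries (k : ℕ) : Continuous (besselSeries k) :=
  continuous_iff_continuousAt.2 fun t => (hasDerivAt_besselSeries k t).continuousAt

/-- The contiguity relation, equivalently the differential equation `t g'' + (k+1) g' = g`. -/
theorem besselSeries_recurrence (k : ℕ) (t : ℝ) :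
    besselSeries k t = (k + 1) * besselSeries (k + 1) t + t * besselSeries (k + 2) t := by
  have h0 := summable_besselSeries k t
  have h1 := (summable_besselSeries (k + 1) t).mul_left ((k : ℝ) + 1)
  have h2 := (summable_besselSeries (k + 2) t).mul_left t
  unfold besselSeries
  rw [← tsum_mul_left, ← tsum_mul_left, h0.tsum_eq_zero_add, h1.tsum_eq_zero_add, add_assoc]
  rw [← Summable.tsum_add ((summable_nat_add_iff 1).2 h1) h2]
  congr 1
  · have : (k.factorial : ℝ) ≠ 0 := by exact_mod_cast Nat.factorial_ne_zero k
    have h4 : ((k : ℝ) + 1) ≠ 0 := by positivity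
    simp only [zero_add, Nat.factorial_succ k]
    push_cast
    field_simp
  · congr 1
    ext m
    have h2 : (m.factorial : ℝ) ≠ 0 := by exact_mod_cast Nat.factorial_ne_zero m
    have h3 : ((m + k + 1).factorial : ℝ) ≠ 0 := by exact_mod_cast Nat.factorial_ne_zero _
    have h4 : ((m : ℝ) + 1) ≠ 0 := by positivity
    have h5 : ((m : ℝ) + k + 1 + 1) ≠ 0 := by positivity
    rw [show m + 1 + k = m + k + 1 by ring, show m + 1 + (k + 1) = m + k + 1 + 1 by ring,
      show m + (k + 2) = m + k + 1 + 1 by ring, Nat.factorial_succ m, Nat.factorial_succ (m + k + 1)]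
    push_cast
    field_simp
    ring

theorem besselSeries_pos (k : ℕ) {t : ℝ} (ht : 0 ≤ t) : 0 < besselSeries k t := by
  refine (summable_besselSeries k t).tsum_pos (fun m => by positivity) 0 ?_
  simp only [pow_zero]
  positivity

/-! ### Derivatives, recurrences and signs of `J_k` and `I_k` -/

theorem besselJ_eq (k : ℕ) (x : ℝ) :
    besselJ k x = (x / 2) ^ k * besselSeries k (-(x / 2) ^ 2) := by
  unfold besselJ besselSeries
  rw [← tsum_mul_left]
  congr 1
  ext m
  rw [neg_pow ((x / 2) ^ 2), ← pow_mul, pow_add]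
  ring

theorem besselI_eq (k : ℕ) (x : ℝ) :
    besselI k x = (x / 2) ^ k * besselSeries k ((x / 2) ^ 2) := by
  unfold besselI besselSeries
  rw [← tsum_mul_left]
  congr 1
  ext m
  rw [← pow_mul, pow_add]
  ring

theorem continuous_besselJ (k : ℕ) : Continuous (besselJ k) := by
  have := continuous_besselSeries k
  rw [show besselJ k = _ from funext (besselJ_eq k)]
  fun_prop

theorem continuous_besselI (k : ℕ) : Continuous (besselI k) := by
  have := continuous_besselSeries k
  rw [show besselI k = _ from funext (besselI_eq k)]
  fun_prop

theorem besselI_pos (k : ℕ) {x : ℝ} (hx : 0 < x) : 0 < besselI k x := by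
  rw [besselI_eq]
  have := besselSeries_pos k (sq_nonneg (x / 2))
  positivity

theorem besselI_zero_pos (x : ℝ) : 0 < besselI 0 x := by
  rw [besselI_eq]
  simpa using besselSeries_pos 0 (sq_nonneg (x / 2))

theorem hasDerivAt_besselJ (k : ℕ) {x : ℝ} (hx : x ≠ 0) :
    HasDerivAt (besselJ k) (k / x * besselJ k x - besselJ (k + 1) x) x := by
  have h1 : HasDerivAt (fun y : ℝ => y / 2) (1 / 2) x := (hasDerivAt_id x).div_const 2
  have h := (h1.pow k).mul ((hasDerivAt_besselSeries k (-(x / 2) ^ 2)).comp x (h1.pow 2).neg)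
  rw [show besselJ k = _ from funext (besselJ_eq k)]
  refine h.congr_deriv ?_
  rw [besselJ_eq]
  rcases k with _ | k
  · simp
    ring
  · simp only [Nat.add_sub_cancel, Pi.pow_apply, Function.comp, Pi.neg_apply]
    push_cast
    field_simp
    ring

theorem hasDerivAt_besselI (k : ℕ) {x : ℝ} (hx : x ≠ 0) :
    HasDerivAt (besselI k) (k / x * besselI k x + besselI (k + 1) x) x := by
  have h1 : HasDerivAt (fun y : ℝ => y / 2) (1 / 2) x := (hasDerivAt_id x).div_const 2
  have h := (h1.pow k).mul ((hasDerivAt_besselSeries k ((x / 2) ^ 2)).comp x (h1.pow 2))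
  rw [show besselI k = _ from funext (besselI_eq k)]
  refine h.congr_deriv ?_
  rw [besselI_eq]
  rcases k with _ | k
  · simp
    ring
  · simp only [Nat.add_sub_cancel, Pi.pow_apply, Function.comp]
    push_cast
    field_simp
    ring

theorem besselJ_recurrence (k : ℕ) {x : ℝ} (hx : x ≠ 0) :
    besselJ (k + 2) x = 2 * (k + 1) / x * besselJ (k + 1) x - besselJ k x := by
  simp only [besselJ_eq]
  rw [besselSeries_recurrence k]
  field_simp
  ring

theorem besselI_recurrence (k : ℕ) {x : ℝ} (hx : x ≠ 0) :
    besselI (k + 2) x = besselI k x - 2 * (k + 1) / x * besselI (k + 1) x := by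
  simp only [besselI_eq]
  rw [besselSeries_recurrence k]
  field_simp
  ring

theorem hasDerivAt_besselJ_succ (k : ℕ) {x : ℝ} (hx : x ≠ 0) :
    HasDerivAt (besselJ (k + 1)) (besselJ k x - (k + 1) / x * besselJ (k + 1) x) x := by
  refine (hasDerivAt_besselJ (k + 1) hx).congr_deriv ?_
  rw [show k + 1 + 1 = k + 2 from rfl, besselJ_recurrence k hx]
  push_cast
  ring

theorem hasDerivAt_besselI_succ (k : ℕ) {x : ℝ} (hx : x ≠ 0) :
    HasDerivAt (besselI (k + 1)) (besselI k x - (k + 1) / x * besselI (k + 1) x) x := by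
  refine (hasDerivAt_besselI (k + 1) hx).congr_deriv ?_
  rw [show k + 1 + 1 = k + 2 from rfl, besselI_recurrence k hx]
  push_cast
  ring

/-- `J_k` is positive on a right neighbourhood of `0`. -/
theorem exists_besselJ_pos (k : ℕ) : ∃ δ > 0, ∀ x ∈ Ioo (0 : ℝ) δ, 0 < besselJ k x := by
  have hc : ContinuousAt (fun x : ℝ => besselSeries k (-(x / 2) ^ 2)) 0 := by
    have := continuous_besselSeries k
    fun_prop
  have h0 : 0 < besselSeries k (-((0 : ℝ) / 2) ^ 2) := by
    simpa using besselSeries_pos k le_rfl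
  obtain ⟨δ, hδ, h⟩ := Metric.eventually_nhds_iff.1 (hc.eventually (lt_mem_nhds h0))
  refine ⟨δ, hδ, fun x hx => ?_⟩
  have hx' := h (y := x) (by simpa [abs_of_pos hx.1] using hx.2)
  have := hx.1
  rw [besselJ_eq]
  positivity

/-! ### The weighted Wronskian and its relation to `F_k` -/

/-- The weighted Wronskian `r (u v' - v u')` of `u = J_k(a r)` and `v = I_k(b r)`, written without
derivatives. -/
def besselWronskian (k : ℕ) (a b r : ℝ) : ℝ :=
  r * (b * besselJ k (a * r) * besselI (k + 1) (b * r)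
    + a * besselI k (b * r) * besselJ (k + 1) (a * r))

theorem continuous_besselWronskian (k : ℕ) (a b : ℝ) : Continuous (besselWronskian k a b) := by
  have h1 := continuous_besselJ k
  have h2 := continuous_besselI k
  have h3 := continuous_besselJ (k + 1)
  have h4 := continuous_besselI (k + 1)
  unfold besselWronskian
  fun_prop

theorem hasDerivAt_comp_const_mul {f : ℝ → ℝ} {f' a r : ℝ} (h : HasDerivAt f f' (a * r)) :
    HasDerivAt (fun s => f (a * s)) (f' * a) r := by
  have h1 : HasDerivAt (fun s : ℝ => a * s) a r := by
    simpa using (hasDerivAt_id r).const_mul a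
  exact h.comp r h1

/-- Subtracting `(r u')' = (k²/r - a² r) u` times `v` from `(r v')' = (k²/r + b² r) v` times `u`
cancels the `k²` terms. -/
theorem hasDerivAt_besselWronskian (k : ℕ) {a b r : ℝ} (ha : a ≠ 0) (hb : b ≠ 0) (hr : r ≠ 0) :
    HasDerivAt (besselWronskian k a b)
      ((a ^ 2 + b ^ 2) * r * (besselJ k (a * r) * besselI k (b * r))) r := by
  have har := mul_ne_zero ha hr
  have hbr := mul_ne_zero hb hr
  have h1 := hasDerivAt_comp_const_mul (hasDerivAt_besselJ k har)
  have h2 := hasDerivAt_comp_const_mul (hasDerivAt_besselI k hbr)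
  have h3 := hasDerivAt_comp_const_mul (hasDerivAt_besselJ_succ k har)
  have h4 := hasDerivAt_comp_const_mul (hasDerivAt_besselI_succ k hbr)
  refine ((hasDerivAt_id r).mul (((h1.const_mul b).mul h4).add ((h2.const_mul a).mul h3))).congr_deriv
    ?_
  simp only [id, Pi.add_apply, Pi.mul_apply]
  field_simp
  ring

theorem besselWronskian_zero (k : ℕ) (a b : ℝ) : besselWronskian k a b 0 = 0 := by
  simp [besselWronskian]

theorem charF_eq_besselWronskian {κ α : ℝ} (hκ : 0 < κ) (k : ℕ) (hα : 0 < α) :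
    charF κ k α = besselWronskian k α (κ / α) 1 := by
  have hb : κ / α ≠ 0 := by positivity
  unfold charF besselWronskian
  rw [(hasDerivAt_besselJ k hα.ne').deriv, (hasDerivAt_besselI k hb).deriv]
  simp only [mul_one, one_mul]
  field_simp
  ring

theorem continuousOn_charF {κ : ℝ} (hκ : 0 < κ) (k : ℕ) : ContinuousOn (charF κ k) (Ioi 0) := by
  have h1 := continuous_besselJ k
  have h2 := continuous_besselI k
  have h3 := continuous_besselJ (k + 1)
  have h4 := continuous_besselI (k + 1)
  have hd : ContinuousOn (fun α : ℝ => κ / α) (Ioi 0) :=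
    continuousOn_const.div continuousOn_id fun x hx => (ne_of_gt hx)
  refine ContinuousOn.congr (f := fun α => besselWronskian k α (κ / α) 1) ?_
    fun α hα => charF_eq_besselWronskian hκ k hα
  unfold besselWronskian
  simp only [mul_one, one_mul]
  exact ((hd.mul h1.continuousOn).mul (h4.comp_continuousOn hd)).add
    ((continuousOn_id.mul (h2.comp_continuousOn hd)).mul h3.continuousOn)

theorem besselWronskian_strictMonoOn {k : ℕ} {a b p : ℝ} (ha : 0 < a) (hb : 0 < b)
    (hJ : ∀ r ∈ Ioo 0 p, 0 < besselJ k (a * r)) :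
    StrictMonoOn (besselWronskian k a b) (Icc 0 p) := by
  refine strictMonoOn_of_deriv_pos (convex_Icc 0 p) (continuous_besselWronskian k a b).continuousOn ?_
  intro r hr
  rw [interior_Icc] at hr
  rw [(hasDerivAt_besselWronskian k ha.ne' hb.ne' hr.1.ne').deriv]
  have h1 := hJ r hr
  have h2 := besselI_pos k (mul_pos hb hr.1)
  have h3 := hr.1
  positivity

theorem besselWronskian_strictAntiOn {k : ℕ} {a b p q : ℝ} (ha : 0 < a) (hb : 0 < b) (hp : 0 ≤ p)
    (hJ : ∀ r ∈ Ioo p q, besselJ k (a * r) < 0) :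
    StrictAntiOn (besselWronskian k a b) (Icc p q) := by
  refine strictAntiOn_of_deriv_neg (convex_Icc p q) (continuous_besselWronskian k a b).continuousOn ?_
  intro r hr
  rw [interior_Icc] at hr
  have h3 : 0 < r := hp.trans_lt hr.1
  rw [(hasDerivAt_besselWronskian k ha.ne' hb.ne' h3.ne').deriv]
  have h2 := besselI_pos k (mul_pos hb h3)
  exact mul_neg_of_pos_of_neg (by positivity) (mul_neg_of_neg_of_pos (hJ r hr) h2)

/-! ### Signs of `J_k` while `F_k` is positive -/

/-- `F_k` is positive up to the first zero of `J_k`. -/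
theorem charF_pos_of_besselJ_pos {κ α : ℝ} (hκ : 0 < κ) {k : ℕ} (hα : 0 < α)
    (hJ : ∀ x ∈ Ioo 0 α, 0 < besselJ k x) : 0 < charF κ k α := by
  rw [charF_eq_besselWronskian hκ k hα, ← besselWronskian_zero k α (κ / α)]
  refine besselWronskian_strictMonoOn (p := 1) hα (by positivity) (fun r hr => hJ _ ?_)
    (by simp) (by simp) one_pos
  exact ⟨mul_pos hα hr.1, by nlinarith [hr.2]⟩

theorem deriv_besselI_pos (k : ℕ) {x : ℝ} (hx : 0 < x) : 0 < deriv (besselI k) x := by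
  rw [(hasDerivAt_besselI k hx.ne').deriv]
  have h1 := besselI_pos k hx
  have h2 := besselI_pos (k + 1) hx
  positivity

/-- Where `F_k` is positive, `J_k ≤ 0` forces `J_k' < 0`. -/
theorem deriv_besselJ_neg {κ α : ℝ} (hκ : 0 < κ) {k : ℕ} (hα : 0 < α) (hF : 0 < charF κ k α)
    (hJ : besselJ k α ≤ 0) : deriv (besselJ k) α < 0 := by
  have hb : 0 < κ / α := by positivity
  have h1 := besselI_pos k hb
  have h2 := deriv_besselI_pos k hb
  -- If `J_k' ≥ 0`, neither term of `F_k` is positive.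
  by_contra! h
  have h3 : κ / α * besselJ k α * deriv (besselI k) (κ / α) ≤ 0 :=
    mul_nonpos_of_nonpos_of_nonneg (mul_nonpos_of_nonneg_of_nonpos hb.le hJ) h2.le
  have h4 : 0 ≤ α * besselI k (κ / α) * deriv (besselJ k) α := by positivity
  unfold charF at hF
  linarith

theorem differentiableAt_besselJ (k : ℕ) {x : ℝ} (hx : 0 < x) : DifferentiableAt ℝ (besselJ k) x :=
  (hasDerivAt_besselJ k hx.ne').differentiableAt

/-- As long as `F_k` stays positive, `J_k` stays negative once it is nonpositive. -/
theorem besselJ_neg_of_charF_pos {κ : ℝ} (hκ : 0 < κ) {k : ℕ} {p q : ℝ} (hp : 0 < p) (hpq : p < q)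
    (hF : ∀ x ∈ Ico p q, 0 < charF κ k x) (hJ : besselJ k p ≤ 0) :
    ∀ x ∈ Ioc p q, besselJ k x < 0 := by
  have hle : ∀ x ∈ Icc p q, besselJ k x ≤ 0 := by
    -- Barrier argument: wherever `J_k` touches 0 its derivative is negative, so it cannot cross
    -- upwards.
    refine image_le_of_deriv_right_lt_deriv_boundary' (f' := fun x => deriv (besselJ k) x)
      (B := fun _ => 0) (B' := fun _ => 0) (continuous_besselJ k).continuousOn
      (fun x hx => ((differentiableAt_besselJ k (hp.trans_le hx.1)).hasDerivAt).hasDerivWithinAt)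
      hJ continuousOn_const (fun x _ => hasDerivWithinAt_const _ _ _)
      (fun x hx h => deriv_besselJ_neg hκ (hp.trans_le hx.1) (hF x hx) h.le)
  have hanti : StrictAntiOn (besselJ k) (Icc p q) := by
    refine strictAntiOn_of_deriv_neg (convex_Icc p q) (continuous_besselJ k).continuousOn ?_
    intro x hx
    rw [interior_Icc] at hx
    exact deriv_besselJ_neg hκ (hp.trans hx.1) (hF x ⟨hx.1.le, hx.2⟩) (hle x ⟨hx.1.le, hx.2.le⟩)
  intro x hx
  exact (hanti (left_mem_Icc.2 hpq.le) ⟨hx.1.le, hx.2⟩ hx.1).trans_le hJ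

/-! ### Sturm comparison and existence of a root -/

/-- `w = √x J_k(x)` solves `w'' = -(1 + (1/4 - k²)/x²) w`; this is its Wronskian with
`sin ((x - a)/2)`. -/
def sturmWronskian (k : ℕ) (a x : ℝ) : ℝ :=
  √x * (((k + 1 / 2) / x * besselJ k x - besselJ (k + 1) x) * Real.sin ((x - a) / 2)
    - besselJ k x * (Real.cos ((x - a) / 2) / 2))

theorem hasDerivAt_sturmWronskian (k : ℕ) (a : ℝ) {x : ℝ} (hx : 0 < x) :
    HasDerivAt (sturmWronskian k a)
      (-(√x * besselJ k x * Real.sin ((x - a) / 2)) * (3 / 4 + (1 / 4 - k ^ 2) / x ^ 2)) x := by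
  have h1 := hasDerivAt_besselJ k hx.ne'
  have h2 := hasDerivAt_besselJ_succ k hx.ne'
  have hl : HasDerivAt (fun y : ℝ => (y - a) / 2) (1 / 2) x :=
    ((hasDerivAt_id x).sub_const a).div_const 2
  have hs := hl.sin
  have hc := hl.cos.div_const 2
  have hq := Real.hasDerivAt_sqrt hx.ne'
  have hi : HasDerivAt (fun y : ℝ => ((k : ℝ) + 1 / 2) / y) _ x :=
    (hasDerivAt_const x ((k : ℝ) + 1 / 2)).div (hasDerivAt_id x) hx.ne'
  refine (hq.mul ((((hi.mul h1).sub h2).mul hs).sub (h1.mul hc))).congr_deriv ?_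
  have hsq : 0 < √x := Real.sqrt_pos.2 hx
  simp only [Pi.mul_apply, Pi.sub_apply]
  generalize besselJ k x = A
  generalize besselJ (k + 1) x = B
  generalize Real.sin ((x - a) / 2) = S
  generalize Real.cos ((x - a) / 2) = C
  have hx2 : x = √x ^ 2 := (Real.sq_sqrt hx.le).symm
  generalize √x = q at *
  subst hx2
  field_simp
  ring

/-- Sturm comparison with `sin ((x - a)/2)` on an interval of length `2π`: if `σ J_k ≥ 0` there,
then `σ J_k` vanishes at its left end. -/
theorem sturm_comparison {k : ℕ} {a σ : ℝ} (ha : 0 < a) (hak : 2 * (k : ℝ) ≤ a)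
    (hJ : ∀ x ∈ Icc a (a + 2 * Real.pi), 0 ≤ σ * besselJ k x) : σ * besselJ k a ≤ 0 := by
  have hpi := Real.pi_pos
  have hanti : AntitoneOn (fun x => σ * sturmWronskian k a x) (Icc a (a + 2 * Real.pi)) := by
    have hd : ∀ x, 0 < x → HasDerivAt (fun x => σ * sturmWronskian k a x) _ x :=
      fun x hx => (hasDerivAt_sturmWronskian k a hx).const_mul σ
    refine antitoneOn_of_deriv_nonpos (convex_Icc _ _)
      (fun x hx => (hd x (ha.trans_le hx.1)).continuousAt.continuousWithinAt)
      (fun x hx => ?_) (fun x hx => ?_)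
    · rw [interior_Icc] at hx
      exact (hd x (ha.trans hx.1)).differentiableAt.differentiableWithinAt
    · rw [interior_Icc] at hx
      have hx0 := ha.trans hx.1
      rw [(hd x hx0).deriv]
      have h1 := hJ x ⟨hx.1.le, hx.2.le⟩
      have h2 : 0 ≤ Real.sin ((x - a) / 2) :=
        Real.sin_nonneg_of_nonneg_of_le_pi (by linarith [hx.1]) (by linarith [hx.2])
      -- From `x > a ≥ 2k` one has `k²/x² ≤ 1/4`.
      have h3 : 0 ≤ 3 / 4 + (1 / 4 - (k : ℝ) ^ 2) / x ^ 2 := by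
        have hk : (0 : ℝ) ≤ k := Nat.cast_nonneg k
        have : 0 ≤ (3 * x ^ 2 + 1 - 4 * (k : ℝ) ^ 2) / (4 * x ^ 2) := by
          apply div_nonneg _ (by positivity)
          nlinarith [hx.1]
        convert this using 1
        field_simp
        ring
      have h4 := mul_nonneg (mul_nonneg (mul_nonneg h1 (Real.sqrt_nonneg x)) h2) h3
      linarith
  have hle := hanti (left_mem_Icc.2 (by linarith)) (right_mem_Icc.2 (by linarith))
    (by linarith : a ≤ a + 2 * Real.pi)
  have e : (a + 2 * Real.pi - a) / 2 = Real.pi := by ring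
  -- The sine vanishes at both ends and the cosine is `1`, then `-1`, so only multiples of `J_k` of
  -- opposite sign remain.
  simp only [sturmWronskian, e, sub_self, zero_div, Real.sin_zero, Real.cos_zero, Real.sin_pi,
    Real.cos_pi] at hle
  have hb := hJ _ (right_mem_Icc.2 (by linarith : a ≤ a + 2 * Real.pi))
  have hb' := mul_nonneg (Real.sqrt_nonneg (a + 2 * Real.pi)) hb
  have hq : 0 < √a := Real.sqrt_pos.2 ha
  have : √a * (σ * besselJ k a) ≤ 0 := by linarith
  exact nonpos_of_mul_nonpos_right this hq

theorem posRoots_nonempty {κ : ℝ} (hκ : 0 < κ) (k : ℕ) : (posRoots κ k).Nonempty := by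
  by_contra hne
  have hroot : ∀ x, 0 < x → charF κ k x ≠ 0 := fun x hx h => hne ⟨x, hx, h⟩
  have hpi := Real.pi_pos
  have hF : ∀ x, 0 < x → 0 < charF κ k x := by
    obtain ⟨δ, hδ, hJ⟩ := exists_besselJ_pos k
    intro x hx
    by_contra! hneg
    obtain ⟨y, hy, hy0⟩ := isPreconnected_Ioi.intermediate_value (a := x) (b := δ) hx hδ
      (continuousOn_charF hκ k) ⟨hneg, (charF_pos_of_besselJ_pos hκ hδ hJ).le⟩
    exact hroot y hy hy0
  have hneg : ∃ p, 0 < p ∧ 2 * (k : ℝ) ≤ p ∧ besselJ k p < 0 := by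
    by_contra! hnn
    -- If `J_k` were never negative beyond `2k`, comparison started at each such `x` would make it
    -- vanish there, yet with `F_k > 0` a zero is followed by negative values. The `+ 1` keeps the
    -- starting point positive for `k = 0`.
    have hz : ∀ x, 2 * (k : ℝ) + 1 ≤ x → besselJ k x ≤ 0 := fun x hx => by
      have hk : (0 : ℝ) ≤ k := Nat.cast_nonneg k
      have := sturm_comparison (k := k) (a := x) (σ := 1) (by linarith) (by linarith)
        (fun y hy => by
          simpa using hnn y (by linarith [hy.1]) (by linarith [hy.1]))
      simpa using this
    have hk : (0 : ℝ) < 2 * (k : ℝ) + 1 := by positivity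
    have h1 := besselJ_neg_of_charF_pos hκ (q := 2 * (k : ℝ) + 2) hk (by linarith)
      (fun x hx => hF x (hk.trans_le hx.1)) (hz _ le_rfl) (2 * (k : ℝ) + 2) ⟨by linarith, le_rfl⟩
    exact absurd h1 (not_lt.2 (hnn _ (by linarith) (by linarith)))
  obtain ⟨p, hp, hkp, hJp⟩ := hneg
  have hlt : ∀ x, p ≤ x → besselJ k x < 0 := fun x hx => by
    rcases hx.eq_or_lt with rfl | hx
    · exact hJp
    · exact besselJ_neg_of_charF_pos hκ hp hx (fun y hy => hF y (hp.trans_le hy.1)) hJp.le x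
        ⟨hx, le_rfl⟩
  have := sturm_comparison (k := k) (a := p) (σ := -1) hp hkp
    (fun y hy => by linarith [hlt y hy.1])
  linarith

/-! ### The first root and the sign of the Wronskian there -/

/-- Positivity of `F_k` near 0 keeps the roots in some `[δ, ∞)`, where `F_k` is continuous; the root
set is therefore closed and contains its infimum. -/
theorem isLeast_alphaOne {κ : ℝ} (hκ : 0 < κ) (k : ℕ) :
    IsLeast (posRoots κ k) (alphaOne κ k) := by
  obtain ⟨δ, hδ, hJ⟩ := exists_besselJ_pos k
  have hlb : ∀ x ∈ posRoots κ k, δ ≤ x := fun x hx => by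
    by_contra! h
    have := charF_pos_of_besselJ_pos hκ hx.1 fun y hy => hJ y ⟨hy.1, hy.2.trans h⟩
    exact this.ne' hx.2
  have heq : posRoots κ k = Ici δ ∩ charF κ k ⁻¹' {0} := by
    ext x
    exact ⟨fun hx => ⟨hlb x hx, hx.2⟩, fun hx => ⟨hδ.trans_le hx.1, hx.2⟩⟩
  have hcl : IsClosed (posRoots κ k) := by
    rw [heq]
    exact ((continuousOn_charF hκ k).mono fun x hx => hδ.trans_le hx).preimage_isClosed_of_isClosed
      isClosed_Ici isClosed_singleton
  have hbdd : BddBelow (posRoots κ k) := ⟨δ, hlb⟩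
  exact ⟨hcl.csInf_mem (posRoots_nonempty hκ k) hbdd, fun x hx => csInf_le hbdd hx⟩

theorem charF_pos_of_lt_alphaOne {κ : ℝ} (hκ : 0 < κ) (k : ℕ) {x : ℝ} (hx : 0 < x)
    (hlt : x < alphaOne κ k) : 0 < charF κ k x := by
  obtain ⟨δ, hδ, hJ⟩ := exists_besselJ_pos k
  by_contra! hneg
  set y := min x δ
  have hy : 0 < y := lt_min hx hδ
  have hFy : 0 < charF κ k y :=
    charF_pos_of_besselJ_pos hκ hy fun z hz => hJ z ⟨hz.1, hz.2.trans_le (min_le_right _ _)⟩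
  obtain ⟨z, hz, hz0⟩ := intermediate_value_Icc' (min_le_left x δ)
    ((continuousOn_charF hκ k).mono fun z hz => hy.trans_le hz.1) ⟨hneg, hFy.le⟩
  have := (isLeast_alphaOne hκ k).2 (show z ∈ posRoots κ k from ⟨hy.trans_le hz.1, hz0⟩)
  linarith [hz.2]

theorem alphaOne_pos {κ : ℝ} (hκ : 0 < κ) (k : ℕ) : 0 < alphaOne κ k :=
  (isLeast_alphaOne hκ k).1.1

/-- `J_k` changes sign exactly once on `(0, α_{k,1})`. -/
theorem exists_besselJ_sign_change {κ : ℝ} (hκ : 0 < κ) (k : ℕ) :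
    ∃ z ∈ Ioo 0 (alphaOne κ k), (∀ x ∈ Ioo 0 z, 0 < besselJ k x) ∧
      ∀ x ∈ Ioc z (alphaOne κ k), besselJ k x < 0 := by
  set α := alphaOne κ k with hαdef
  have hα : 0 < α := alphaOne_pos hκ k
  obtain ⟨δ, hδ, hJ⟩ := exists_besselJ_pos k
  have hF : ∀ x, 0 < x → x < α → 0 < charF κ k x := fun x hx h => charF_pos_of_lt_alphaOne hκ k hx h
  set S : Set ℝ := {x | x ∈ Ioo 0 α ∧ besselJ k x ≤ 0}
  have hS : S.Nonempty := by
    by_contra hne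
    have hpos : ∀ x ∈ Ioo 0 α, 0 < besselJ k x := fun x hx => by
      by_contra! h
      exact hne ⟨x, hx, h⟩
    -- `J_k > 0` on all of `(0, α)` would give `F_k(α) > 0`.
    exact (charF_pos_of_besselJ_pos hκ hα hpos).ne' (isLeast_alphaOne hκ k).1.2
  have hlb : ∀ x ∈ S, δ ≤ x := fun x hx => by
    by_contra! h
    exact absurd (hJ x ⟨hx.1.1, h⟩) (not_lt.2 hx.2)
  have hbdd : BddBelow S := ⟨δ, hlb⟩
  have hz0 : 0 < sInf S := hδ.trans_le (le_csInf hS hlb)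
  have hzα : sInf S < α := by
    obtain ⟨x, hx⟩ := hS
    exact (csInf_le hbdd hx).trans_lt hx.1.2
  have hzJ : besselJ k (sInf S) ≤ 0 :=
    closure_minimal (fun x hx => hx.2) (isClosed_le (continuous_besselJ k) continuous_const)
      (csInf_mem_closure hS hbdd)
  refine ⟨sInf S, ⟨hz0, hzα⟩, fun x hx => ?_, ?_⟩
  · by_contra! h
    exact absurd (csInf_le hbdd ⟨⟨hx.1, hx.2.trans hzα⟩, h⟩) (not_le.2 hx.2)
  · exact besselJ_neg_of_charF_pos hκ hz0 hzα (fun x hx => hF x (hz0.trans_le hx.1) hx.2) hzJ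

/-- The Wronskian vanishes at 0 and at 1, increases up to `z / α` and decreases after it, where `z`
is the sign change of `J_k`. -/
theorem besselWronskian_alphaOne_pos {κ : ℝ} (hκ : 0 < κ) (k : ℕ) {r : ℝ} (hr : r ∈ Ioo (0 : ℝ) 1) :
    0 < besselWronskian k (alphaOne κ k) (κ / alphaOne κ k) r := by
  obtain ⟨z, hz, hpos, hneg⟩ := exists_besselJ_sign_change hκ k
  have hα := alphaOne_pos hκ k
  have h1 := (charF_eq_besselWronskian hκ k hα).symm.trans (isLeast_alphaOne hκ k).1.2
  set α := alphaOne κ k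
  have hb : 0 < κ / α := by positivity
  have hzα : 0 < z / α := div_pos hz.1 hα
  rcases le_total r (z / α) with h | h
  · rw [← besselWronskian_zero k α (κ / α)]
    refine besselWronskian_strictMonoOn hα hb (fun s hs => hpos _ ⟨mul_pos hα hs.1, ?_⟩)
      (left_mem_Icc.2 hzα.le) ⟨hr.1.le, h⟩ hr.1
    rw [mul_comm]
    exact (lt_div_iff₀ hα).1 hs.2
  · rw [← h1]
    refine besselWronskian_strictAntiOn (p := z / α) (q := 1) hα hb hzα.le
      (fun s hs => hneg _ ⟨?_, ?_⟩) ⟨h, hr.2.le⟩ (right_mem_Icc.2 (h.trans hr.2.le)) hr.2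
    · rw [mul_comm]
      exact (div_lt_iff₀ hα).1 hs.1
    · nlinarith [hs.2]

/-! ### Monotone quotient and absence of zeros -/

/-- The derivative is `-W/(r v²)`. Positivity of the denominator is a hypothesis so that `p = 0` is
allowed when `k = 0`; for `k > 0` the function `I_k` vanishes at 0. -/
theorem bessel_quotient_strictAntiOn {κ : ℝ} (hκ : 0 < κ) (k : ℕ) {p : ℝ} (hp : 0 ≤ p)
    (hI : ∀ r ∈ Icc p 1, 0 < besselI k (κ / alphaOne κ k * r)) :
    StrictAntiOn (fun r => besselJ k (alphaOne κ k * r) / besselI k (κ / alphaOne κ k * r))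
      (Icc p 1) := by
  have hα := alphaOne_pos hκ k
  have hW := fun r hr => besselWronskian_alphaOne_pos hκ k (r := r) hr
  set α := alphaOne κ k
  have hb : 0 < κ / α := by positivity
  set b := κ / α
  have hJc := continuous_besselJ k
  have hIc := continuous_besselI k
  refine strictAntiOn_of_deriv_neg (convex_Icc p 1) ?_ fun r hr => ?_
  · exact ContinuousOn.div (by fun_prop) (by fun_prop) fun r hr => (hI r hr).ne'
  · rw [interior_Icc] at hr
    have hr0 : 0 < r := hp.trans_lt hr.1
    have hv := hI r ⟨hr.1.le, hr.2.le⟩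
    have h1 := hasDerivAt_comp_const_mul (hasDerivAt_besselJ k (mul_pos hα hr0).ne')
    have h2 := hasDerivAt_comp_const_mul (hasDerivAt_besselI k (mul_pos hb hr0).ne')
    rw [(h1.fun_div h2 hv.ne').deriv]
    refine div_neg_of_neg_of_pos ?_ (by positivity)
    have hw := div_pos (hW r ⟨hr0, hr.2⟩) hr0
    rw [← neg_pos]
    refine hw.trans_eq ?_
    unfold besselWronskian
    field_simp
    ring

/-- A zero at `p`, together with the zero at 1, would give the quotient the value `-d/c` twice. -/
theorem radial_ne_zero {κ : ℝ} (hκ : 0 < κ) (k : ℕ) {c d p : ℝ} (hcd : (c, d) ≠ (0, 0))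
    (hsys : ClampedSystem κ k (alphaOne κ k) c d) (hp : 0 ≤ p) (hp1 : p < 1)
    (hI : ∀ r ∈ Icc p 1, 0 < besselI k (κ / alphaOne κ k * r)) :
    radial κ k (alphaOne κ k) c d p ≠ 0 := by
  have hlt := bessel_quotient_strictAntiOn hκ k hp hI (left_mem_Icc.2 hp1.le)
    (right_mem_Icc.2 hp1.le) hp1
  have hv1 := hI 1 (right_mem_Icc.2 hp1.le)
  have hvp := hI p (left_mem_Icc.2 hp1.le)
  have h1 := hsys.1
  simp only [mul_one] at hlt hv1
  intro h
  unfold radial at h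
  have hc : c ≠ 0 := by
    rintro rfl
    have : d = 0 := by simpa [hv1.ne'] using h1
    exact hcd (by rw [this])
  have e1 : c * (besselJ k (alphaOne κ k) / besselI k (κ / alphaOne κ k)) = -d := by
    field_simp
    linarith
  have e2 : c * (besselJ k (alphaOne κ k * p) / besselI k (κ / alphaOne κ k * p)) = -d := by
    rw [← mul_div_assoc, div_eq_iff hvp.ne']
    linarith
  exact hlt.ne (mul_left_cancel₀ hc (e1.trans e2.symm))

end BucklingDisk

end

theorem theorem4p2 (κ : ℝ) (hκ : 0 < κ) (k : ℕ) :
    IsLeast (BucklingDisk.posRoots κ k) (BucklingDisk.alphaOne κ k) ∧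
    ∀ c d : ℝ, (c, d) ≠ (0, 0) →
      BucklingDisk.ClampedSystem κ k (BucklingDisk.alphaOne κ k) c d →
      (∀ r ∈ Set.Ioo (0 : ℝ) 1,
        0 < |BucklingDisk.radial κ k (BucklingDisk.alphaOne κ k) c d r|) ∧
      (k = 0 → 0 < |BucklingDisk.radial κ k (BucklingDisk.alphaOne κ k) c d 0|) := by
  have hb : 0 < κ / BucklingDisk.alphaOne κ k := div_pos hκ (BucklingDisk.alphaOne_pos hκ k)
  refine ⟨BucklingDisk.isLeast_alphaOne hκ k, fun c d hcd hsys => ⟨fun r hr => ?_, ?_⟩⟩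
  · exact abs_pos.2 (BucklingDisk.radial_ne_zero hκ k hcd hsys hr.1.le hr.2 fun s hs =>
      BucklingDisk.besselI_pos k (mul_pos hb (hr.1.trans_le hs.1)))
  · rintro rfl
    exact abs_pos.2 (BucklingDisk.radial_ne_zero hκ 0 hcd hsys le_rfl one_pos fun s _ =>
      BucklingDisk.besselI_zero_pos _)
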